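/- Let $1<p<\infty$ and $1/p+1/q=1$. Let $\sigma$ be area measure on the unit disc $\mathbb{D}$, normalized so that $\sigma(\mathbb{D})=1$, and let $A^p$ be the Bergman space of functions $f$ analytic in $\mathbb{D}$ with $\|f\|_{A^p}=\left(\int_{\mathbb{D}}|f|^p\,d\sigma\right)^{1/p}<\infty$. A function $k\in A^q$ is called a kernel of $\phi\in(A^p)^*$ if $\phi(f)=\int_{\mathbb{D}} f\,\overline{k}\,d\sigma$ for all $f\in A^p$. A function $F\in A^p$ with $\|F\|_{A^p}=1$ is called extremal for a functional $\phi\in(A^p)^*$, $\phi\neq 0$, if $\operatorname{Re}\phi(F)=\sup_{\|g\|_{A^p}=1}\operatorname{Re}\phi(g)=\|\phi\|$. **Theorem.** Let $\phi_1,\dots,\phi_N$ be linearly independent elements of $(A^p)^*$ with kernels $k_1,\dots,k_N\in A^q$ respectively, and let $F\in A^p$ with $\|F\|_{A^p}=1$. Then the following are equivalent: 1. $F$ is extremal for some nonzero functional in $(A^p)^*$ that has as a kernel a linear combination of $k_1,\dots,k_N$. 2. Every nonzero functional in $(A^p)^*$ for which $F$ is extremal has as a kernel a linear combination of $k_1,\dots,k_N$.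 3. $\|F\|_{A^p}=\inf\{\|f\|_{A^p} : f\in A^p,\ \phi_1(f)=\phi_1(F),\dots,\phi_N(f)=\phi_N(F)\}$. -/

import Mathlib

open MeasureTheory
open scoped ENNReal ComplexConjugate

/-- Normalized area measure on the open unit disc of the complex plane (total mass one). -/
noncomputable def discMeasure : Measure ℂ :=
  (volume (Metric.ball (0 : ℂ) 1))⁻¹ • volume.restrict (Metric.ball (0 : ℂ) 1)

instance discMeasure_isProbabilityMeasure : IsProbabilityMeasure discMeasure := by
  constructor
  simp only [discMeasure, Measure.smul_apply, Measure.restrict_apply_univ, smul_eq_mul]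
  exact ENNReal.inv_mul_cancel (Metric.measure_ball_pos volume (0 : ℂ) one_pos).ne'
    measure_ball_lt_top.ne

/-- The Bergman space `A^p`: the elements of `L^p` of the unit disc (with normalized area measure)
that are represented by a function analytic in the disc. Such a representative is unique on the
disc. The norm of `A^p` is the norm of `L^p`. -/
noncomputable def Bergman (p : ℝ≥0∞) : Submodule ℂ (Lp ℂ p discMeasure) where
  carrier := {f | ∃ g : ℂ → ℂ, DifferentiableOn ℂ g (Metric.ball 0 1) ∧ f =ᵐ[discMeasure] g}
  zero_mem' := ⟨0, differentiableOn_const 0, Lp.coeFn_zero ℂ p discMeasure⟩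
  add_mem' := by
    rintro f₁ f₂ ⟨g₁, hg₁, h₁⟩ ⟨g₂, hg₂, h₂⟩
    exact ⟨g₁ + g₂, hg₁.add hg₂, (Lp.coeFn_add f₁ f₂).trans (h₁.add h₂)⟩
  smul_mem' := by
    rintro c f ⟨g, hg, h⟩
    exact ⟨c • g, hg.const_smul c, (Lp.coeFn_smul c f).trans (h.const_smul c)⟩

/-- `k ∈ A^q` is a kernel of the functional `φ` on `A^p`:
`φ f` is the integral of `f` times the conjugate of `k`, for all `f ∈ A^p`. -/
def IsKernel {p q : ℝ≥0∞} [Fact (1 ≤ p)] (φ : StrongDual ℂ (Bergman p)) (k : Bergman q) : Prop :=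
  ∀ f : Bergman p,
    φ f = ∫ z, (f : Lp ℂ p discMeasure) z * conj ((k : Lp ℂ q discMeasure) z) ∂discMeasure

/-- `F ∈ A^p` is an extremal function for the nonzero functional `φ`: it has norm one and
`Re φ(F) = sup {Re φ(g) : ‖g‖ = 1} = ‖φ‖`. -/
def IsExtremalFor {p : ℝ≥0∞} [Fact (1 ≤ p)] (φ : StrongDual ℂ (Bergman p)) (F : Bergman p) :
    Prop :=
  φ ≠ 0 ∧ ‖F‖ = 1 ∧
    (φ F).re = sSup {r : ℝ | ∃ g : Bergman p, ‖g‖ = 1 ∧ r = (φ g).re} ∧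
    sSup {r : ℝ | ∃ g : Bergman p, ‖g‖ = 1 ∧ r = (φ g).re} = ‖φ‖

/-- `F` solves the minimal interpolation problem for the functionals `φ j`:
`‖F‖ = inf {‖f‖ : φ j f = φ j F for all j}`. -/
def IsMinimalInterpolant {p : ℝ≥0∞} [Fact (1 ≤ p)] {N : ℕ}
    (φ : Fin N → StrongDual ℂ (Bergman p)) (F : Bergman p) : Prop :=
  ‖F‖ = sInf {r : ℝ | ∃ f : Bergman p, (∀ j, φ j f = φ j F) ∧ r = ‖f‖}

/-! Having a kernel in the span of the `k j` amounts to lying in the span of the `φ j`, so the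
theorem concerns norming functionals of `F`. One in that span forces minimality, by its norm bound.
Conversely, minimality makes `‖F‖` the norm of the class of `F` modulo the common kernel;
Hahn–Banach there gives a norming functional that vanishes on this kernel, hence lies in the span.
The "every" form follows from uniqueness up to scaling, since the `L^p` norm is Gateaux
differentiable for `1 < p < ∞`. -/

/-! ### Norming functionals in a normed space -/

section NormedSpace

variable {E : Type*} [NormedAddCommGroup E] [NormedSpace ℂ E]

/-- A functional attaining its norm at `x` determines the derivative of the norm at `x`. -/
theorem re_eq_norm_mul_of_hasDerivAt_norm {ψ : StrongDual ℂ E} {x g : E} {d : ℝ}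
    (hx : (ψ x).re = ‖ψ‖ * ‖x‖) (hd : HasDerivAt (fun t : ℝ ↦ ‖x + (t : ℂ) • g‖) d 0) :
    (ψ g).re = ‖ψ‖ * d := by
  have hre (t : ℝ) : (ψ (x + (t : ℂ) • g)).re = (ψ x).re + t * (ψ g).re := by simp
  have h₁ : HasDerivAt
      (fun t : ℝ ↦ ‖ψ‖ * ‖x + (t : ℂ) • g‖ - ((ψ x).re + t * (ψ g).re))
      (‖ψ‖ * d - 1 * (ψ g).re) 0 :=
    (hd.const_mul ‖ψ‖).sub (((hasDerivAt_id (0 : ℝ)).mul_const (ψ g).re).const_add (ψ x).re)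
  -- The difference is nonnegative and vanishes at `t = 0`.
  have h₂ : IsLocalMin
      (fun t : ℝ ↦ ‖ψ‖ * ‖x + (t : ℂ) • g‖ - ((ψ x).re + t * (ψ g).re)) 0 := by
    refine Filter.Eventually.of_forall fun t ↦ ?_
    have := (Complex.re_le_norm _).trans (ψ.le_opNorm (x + (t : ℂ) • g))
    rw [hre] at this
    simp only [Complex.ofReal_zero, zero_smul, add_zero, zero_mul, hx] at this ⊢
    linarith
  linarith [h₂.hasDerivAt_eq_zero h₁]

/-- At a point where the norm is Gateaux differentiable, the norming functional is unique up to
scaling. -/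
theorem norm_smul_eq_norm_smul_of_hasDerivAt_norm {ψ χ : StrongDual ℂ E} {x : E}
    (hψ : (ψ x).re = ‖ψ‖ * ‖x‖) (hχ : (χ x).re = ‖χ‖ * ‖x‖)
    (hd : ∀ g : E, ∃ d : ℝ, HasDerivAt (fun t : ℝ ↦ ‖x + (t : ℂ) • g‖) d 0) :
    (‖χ‖ : ℂ) • ψ = (‖ψ‖ : ℂ) • χ := by
  have hre (g : E) : ‖χ‖ * (ψ g).re = ‖ψ‖ * (χ g).re := by
    obtain ⟨d, hd⟩ := hd g
    rw [re_eq_norm_mul_of_hasDerivAt_norm hψ hd, re_eq_norm_mul_of_hasDerivAt_norm hχ hd]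
    ring
  ext g
  -- Real parts at `I • g` give the imaginary parts at `g`.
  have h := hre (Complex.I • g)
  apply Complex.ext
  · simpa using hre g
  · simpa using h

/-- If `x` has minimal norm among the points at which finitely many functionals take the same
values as at `x`, then some norming functional of `x` is a linear combination of them. -/
theorem exists_mem_span_norm_eq_one_of_forall_norm_le {ι : Type*} [Finite ι]
    (φ : ι → StrongDual ℂ E) {x : E} (hx : x ≠ 0)
    (hmin : ∀ y : E, (∀ j, φ j y = φ j x) → ‖x‖ ≤ ‖y‖) :
    ∃ ψ ∈ Submodule.span ℂ (Set.range φ), ‖ψ‖ = 1 ∧ ψ x = ‖x‖ := by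
  have hx' : 0 < ‖x‖ := norm_pos_iff.2 hx
  let S : Submodule ℂ E := ⨅ j, LinearMap.ker (φ j : E →ₗ[ℂ] ℂ)
  -- The coset `x + S` is exactly the set of competitors.
  have hS : ‖(Submodule.Quotient.mk x : E ⧸ S)‖ = ‖x‖ := by
    refine le_antisymm (Submodule.Quotient.norm_mk_le S x) (le_of_forall_pos_le_add fun ε hε ↦ ?_)
    obtain ⟨y, hy, hyε⟩ := Submodule.Quotient.norm_mk_lt (Submodule.Quotient.mk x : E ⧸ S) hε
    refine (hmin y fun j ↦ ?_).trans hyε.le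
    have := (Submodule.mem_iInf _).1 ((Submodule.Quotient.eq S).1 hy) j
    simpa [sub_eq_zero] using this
  obtain ⟨g, hg, hgx⟩ := exists_dual_vector ℂ (Submodule.Quotient.mk x : E ⧸ S)
    (by rw [hS]; exact hx'.ne')
  rw [hS] at hgx
  have hbound (y : E) : ‖g (Submodule.Quotient.mk y)‖ ≤ 1 * ‖y‖ := by
    have h := g.le_opNorm (Submodule.Quotient.mk y)
    rw [hg] at h
    linarith [Submodule.Quotient.norm_mk_le S y]
  let ψ : StrongDual ℂ E := ((g : (E ⧸ S) →ₗ[ℂ] ℂ).comp S.mkQ).mkContinuous 1 hbound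
  have hψx : ψ x = ‖x‖ := hgx
  refine ⟨ψ, ?_, le_antisymm (LinearMap.mkContinuous_norm_le _ zero_le_one _) ?_, hψx⟩
  · have hker : ⨅ j, LinearMap.ker (φ j : E →ₗ[ℂ] ℂ) ≤ LinearMap.ker (ψ : E →ₗ[ℂ] ℂ) := by
      intro y hy
      have : (Submodule.Quotient.mk y : E ⧸ S) = 0 := (Submodule.Quotient.mk_eq_zero S).2 hy
      change g (Submodule.Quotient.mk y) = 0
      rw [this, map_zero]
    have := mem_span_of_iInf_ker_le_ker hker
    obtain ⟨_⟩ := nonempty_fintype ι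
    obtain ⟨c, hc⟩ := (Submodule.mem_span_range_iff_exists_fun ℂ).1 this
    refine (Submodule.mem_span_range_iff_exists_fun ℂ).2 ⟨c, ?_⟩
    ext y
    simpa using LinearMap.congr_fun hc y
  · have h := ψ.le_opNorm x
    rw [hψx, Complex.norm_real, norm_norm] at h
    exact le_of_mul_le_mul_right (by linarith) hx'

end NormedSpace

/-! ### Differentiability of the norm of `L^p` -/

section Lp

variable {α : Type*} [MeasurableSpace α] {μ : Measure α}

/-- Differentiation under the integral sign: for `|t| < 1` the derivative is dominated by the
integrable function `P * (‖f‖ + ‖g‖) ^ P`. -/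
theorem exists_hasDerivAt_integral_norm_add_smul_rpow {p : ℝ≥0∞} (hp : 1 < p) (hp' : p < ∞)
    {f g : α → ℂ} (hf : MemLp f p μ) (hg : MemLp g p μ) :
    ∃ d : ℝ, HasDerivAt (fun t : ℝ ↦ ∫ a, ‖f a + (t : ℂ) * g a‖ ^ p.toReal ∂μ) d 0 := by
  have hp0 : p ≠ 0 := (zero_lt_one.trans hp).ne'
  have hP : 1 < p.toReal := by
    simpa using (ENNReal.toReal_lt_toReal ENNReal.one_ne_top hp'.ne).2 hp
  set P := p.toReal
  have hsum (t : ℝ) : MemLp (fun a ↦ f a + (t : ℂ) * g a) p μ := hf.add (hg.const_mul _)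
  have hderiv (a : α) (t : ℝ) : HasDerivAt (fun t : ℝ ↦ ‖f a + (t : ℂ) * g a‖ ^ P)
      (P * ‖f a + (t : ℂ) * g a‖ ^ (P - 2) * inner ℝ (f a + (t : ℂ) * g a) (g a)) t := by
    have h : HasDerivAt (fun t : ℝ ↦ f a + (t : ℂ) * g a) (g a) t := by
      simpa using (((hasDerivAt_id t).ofReal_comp).mul_const (g a)).const_add (f a)
    exact (hasFDerivAt_norm_rpow (f a + (t : ℂ) * g a) hP).comp_hasDerivAt t h
  have hbound (a : α) (t : ℝ) (ht : t ∈ Metric.ball (0 : ℝ) 1) :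
      ‖P * ‖f a + (t : ℂ) * g a‖ ^ (P - 2) * inner ℝ (f a + (t : ℂ) * g a) (g a)‖ ≤
        P * ‖‖f a‖ + ‖g a‖‖ ^ P := by
    have hsmall : ‖f a + (t : ℂ) * g a‖ ≤ ‖f a‖ + ‖g a‖ := by
      refine (norm_add_le _ _).trans ?_
      rw [norm_mul, Complex.norm_real]
      have : ‖t‖ < 1 := by simpa using ht
      nlinarith [norm_nonneg (g a)]
    have hinner := abs_real_inner_le_norm (f a + (t : ℂ) * g a) (g a)
    set r := ‖f a + (t : ℂ) * g a‖
    set s := ‖f a‖ + ‖g a‖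
    have hr : 0 ≤ r := norm_nonneg _
    have hs : 0 ≤ s := by positivity
    have hgs : ‖g a‖ ≤ s := le_add_of_nonneg_left (norm_nonneg _)
    rw [norm_mul, norm_mul, Real.norm_of_nonneg (by linarith : 0 ≤ P),
      Real.norm_of_nonneg (by positivity : 0 ≤ r ^ (P - 2)), Real.norm_of_nonneg hs, mul_assoc]
    refine mul_le_mul_of_nonneg_left ?_ (by linarith)
    -- The exponent `P - 2` may be negative, but at `r = 0` the inner product vanishes.
    rcases hr.eq_or_lt with h0 | h0
    · rw [← h0, zero_mul] at hinner
      rw [Real.norm_eq_abs, le_antisymm hinner (abs_nonneg _), mul_zero]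
      positivity
    · have hs' : 0 < s := h0.trans_le hsmall
      calc r ^ (P - 2) * ‖inner ℝ (f a + (t : ℂ) * g a) (g a)‖
          ≤ r ^ (P - 2) * (r * ‖g a‖) := by gcongr; exact hinner
        _ = r ^ (P - 1) * ‖g a‖ := by
          rw [← mul_assoc, ← Real.rpow_add_one h0.ne']; ring_nf
        _ ≤ s ^ (P - 1) * s := by gcongr
        _ = s ^ P := by rw [← Real.rpow_add_one hs'.ne']; ring_nf
  refine ⟨_, (hasDerivAt_integral_of_dominated_loc_of_deriv_le
    (Metric.ball_mem_nhds (0 : ℝ) one_pos)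
    (Filter.Eventually.of_forall fun t ↦
      ((hsum t).integrable_norm_rpow hp0 hp'.ne).aestronglyMeasurable)
    ((hsum 0).integrable_norm_rpow hp0 hp'.ne) ?_
    (Filter.Eventually.of_forall hbound)
    (((hf.norm.add hg.norm).integrable_norm_rpow hp0 hp'.ne).const_mul P)
    (Filter.Eventually.of_forall fun a t _ ↦ hderiv a t)).2⟩
  have h₁ := (hsum 0).aestronglyMeasurable
  exact (((h₁.norm.aemeasurable.pow_const (P - 2)).const_mul P).aestronglyMeasurable).mul
    (h₁.inner hg.aestronglyMeasurable)

theorem Lp_norm_eq_integral_rpow {p : ℝ≥0∞} (hp : p ≠ 0) (hp' : p ≠ ∞) (f : Lp ℂ p μ) :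
    ‖f‖ = (∫ a, ‖f a‖ ^ p.toReal ∂μ) ^ p.toReal⁻¹ := by
  rw [Lp.norm_def, (Lp.memLp f).eLpNorm_eq_integral_rpow_norm hp hp',
    ENNReal.toReal_ofReal (by positivity)]

/-- For `1 < p < ∞`, the norm of `L^p` is Gateaux differentiable away from the origin. -/
theorem Lp_exists_hasDerivAt_norm_add_smul {p : ℝ≥0∞} [Fact (1 ≤ p)] (hp : 1 < p) (hp' : p < ∞)
    {f : Lp ℂ p μ} (hf : f ≠ 0) (g : Lp ℂ p μ) :
    ∃ d : ℝ, HasDerivAt (fun t : ℝ ↦ ‖f + (t : ℂ) • g‖) d 0 := by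
  have hp0 : p ≠ 0 := (zero_lt_one.trans hp).ne'
  obtain ⟨d, hd⟩ := exists_hasDerivAt_integral_norm_add_smul_rpow hp hp' (Lp.memLp f) (Lp.memLp g)
  have hnorm (t : ℝ) : ‖f + (t : ℂ) • g‖ =
      (∫ a, ‖f a + (t : ℂ) * g a‖ ^ p.toReal ∂μ) ^ p.toReal⁻¹ := by
    rw [Lp_norm_eq_integral_rpow hp0 hp'.ne]
    congr 1
    refine integral_congr_ae ?_
    filter_upwards [Lp.coeFn_add f ((t : ℂ) • g), Lp.coeFn_smul (t : ℂ) g] with a h₁ h₂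
    rw [h₁, Pi.add_apply, h₂, Pi.smul_apply, smul_eq_mul]
  simp_rw [hnorm]
  -- The outer power is differentiable away from zero; a zero integral at `t = 0` would give `f =
  -- 0`.
  refine ⟨_, hd.rpow_const (Or.inl fun h0 ↦ hf ?_)⟩
  have := hnorm 0
  rw [h0, Real.zero_rpow (inv_ne_zero (ENNReal.toReal_pos hp0 hp'.ne).ne')] at this
  simpa using this

end Lp

/-! ### Kernels and extremal functions -/

section Bergman

variable {p q : ℝ≥0∞} [Fact (1 ≤ p)]

omit [Fact (1 ≤ p)] in
theorem integrable_mul_conj [p.HolderConjugate q] (f : Bergman p) (k : Bergman q) :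
    Integrable (fun z ↦ (f : Lp ℂ p discMeasure) z * conj ((k : Lp ℂ q discMeasure) z))
      discMeasure :=
  (Lp.memLp (f : Lp ℂ p discMeasure)).integrable_mul (Lp.memLp (k : Lp ℂ q discMeasure)).star

theorem IsKernel.add [p.HolderConjugate q] {φ ψ : StrongDual ℂ (Bergman p)} {k l : Bergman q}
    (hk : IsKernel φ k) (hl : IsKernel ψ l) : IsKernel (φ + ψ) (k + l) := by
  intro f
  rw [add_apply, hk f, hl f,
    ← integral_add (integrable_mul_conj f k) (integrable_mul_conj f l)]
  refine integral_congr_ae ?_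
  filter_upwards [Lp.coeFn_add (k : Lp ℂ q discMeasure) l] with z hz
  rw [Submodule.coe_add, hz, Pi.add_apply, map_add, mul_add]

theorem IsKernel.smul {φ : StrongDual ℂ (Bergman p)} {k : Bergman q}
    (hk : IsKernel φ k) (c : ℂ) : IsKernel (c • φ) (conj c • k) := by
  intro f
  rw [smul_apply, hk f, smul_eq_mul, ← integral_const_mul]
  refine integral_congr_ae ?_
  filter_upwards [Lp.coeFn_smul (conj c) (k : Lp ℂ q discMeasure)] with z hz
  rw [Submodule.coe_smul, hz, Pi.smul_apply, smul_eq_mul, map_mul, Complex.conj_conj]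
  ring

theorem isKernel_zero : IsKernel (0 : StrongDual ℂ (Bergman p)) (0 : Bergman q) := by
  intro f
  have h : (fun z ↦ (f : Lp ℂ p discMeasure) z *
      conj (((0 : Bergman q) : Lp ℂ q discMeasure) z)) =ᵐ[discMeasure] 0 := by
    filter_upwards [Lp.coeFn_zero ℂ q discMeasure] with z hz
    rw [Submodule.coe_zero, hz]
    simp
  rw [integral_congr_ae h]
  simp

theorem IsKernel.functional_unique {φ ψ : StrongDual ℂ (Bergman p)} {k : Bergman q}
    (hφ : IsKernel φ k) (hψ : IsKernel ψ k) : φ = ψ :=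
  ContinuousLinearMap.ext fun f ↦ (hφ f).trans (hψ f).symm

/-- The functionals with a kernel in the span of `k` are the linear combinations of `φ`. -/
theorem exists_isKernel_mem_span_iff [p.HolderConjugate q] {ι : Type*}
    {φ : ι → StrongDual ℂ (Bergman p)} {k : ι → Bergman q} (hk : ∀ j, IsKernel (φ j) (k j))
    (ψ : StrongDual ℂ (Bergman p)) :
    (∃ κ ∈ Submodule.span ℂ (Set.range k), IsKernel ψ κ) ↔
      ψ ∈ Submodule.span ℂ (Set.range φ) := by
  constructor
  · rintro ⟨κ, hκ, hψ⟩
    suffices ∃ χ ∈ Submodule.span ℂ (Set.range φ), IsKernel χ κ by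
      obtain ⟨χ, hχ, hχκ⟩ := this
      rwa [hψ.functional_unique hχκ]
    clear hψ
    induction hκ using Submodule.span_induction with
    | mem κ h =>
      obtain ⟨j, rfl⟩ := h
      exact ⟨φ j, Submodule.subset_span ⟨j, rfl⟩, hk j⟩
    | zero => exact ⟨0, Submodule.zero_mem _, isKernel_zero⟩
    | add κ κ' _ _ h h' =>
      obtain ⟨χ, hχ, hχκ⟩ := h
      obtain ⟨χ', hχ', hχκ'⟩ := h'
      exact ⟨χ + χ', Submodule.add_mem _ hχ hχ', hχκ.add hχκ'⟩
    | smul c κ _ h =>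
      obtain ⟨χ, hχ, hχκ⟩ := h
      -- Kernels depend antilinearly on functionals; the two conjugations cancel.
      exact ⟨conj c • χ, Submodule.smul_mem _ _ hχ, by simpa using hχκ.smul (conj c)⟩
  · intro hψ
    induction hψ using Submodule.span_induction with
    | mem χ h =>
      obtain ⟨j, rfl⟩ := h
      exact ⟨k j, Submodule.subset_span ⟨j, rfl⟩, hk j⟩
    | zero => exact ⟨0, Submodule.zero_mem _, isKernel_zero⟩
    | add χ χ' _ _ h h' =>
      obtain ⟨κ, hκ, hχκ⟩ := h
      obtain ⟨κ', hκ', hχκ'⟩ := h'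
      exact ⟨κ + κ', Submodule.add_mem _ hκ hκ', hχκ.add hχκ'⟩
    | smul c χ _ h =>
      obtain ⟨κ, hκ, hχκ⟩ := h
      exact ⟨conj c • κ, Submodule.smul_mem _ _ hκ, hχκ.smul c⟩

theorem isExtremalFor_iff {ψ : StrongDual ℂ (Bergman p)} {F : Bergman p} (hF : ‖F‖ = 1) :
    IsExtremalFor ψ F ↔ ψ ≠ 0 ∧ (ψ F).re = ‖ψ‖ := by
  refine ⟨fun h ↦ ⟨h.1, h.2.2.1.trans h.2.2.2⟩, fun ⟨h0, h⟩ ↦ ?_⟩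
  have hgreatest : IsGreatest {r : ℝ | ∃ g : Bergman p, ‖g‖ = 1 ∧ r = (ψ g).re} ‖ψ‖ := by
    refine ⟨⟨F, hF, h.symm⟩, ?_⟩
    rintro r ⟨g, hg, rfl⟩
    simpa [hg] using (Complex.re_le_norm _).trans (ψ.le_opNorm g)
  exact ⟨h0, hF, h.trans hgreatest.csSup_eq.symm, hgreatest.csSup_eq⟩

theorem isMinimalInterpolant_iff {N : ℕ} {φ : Fin N → StrongDual ℂ (Bergman p)} {F : Bergman p} :
    IsMinimalInterpolant φ F ↔ ∀ f : Bergman p, (∀ j, φ j f = φ j F) → ‖F‖ ≤ ‖f‖ := by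
  constructor
  · intro h f hf
    rw [IsMinimalInterpolant] at h
    rw [h]
    refine csInf_le ⟨0, ?_⟩ ⟨f, hf, rfl⟩
    rintro r ⟨g, -, rfl⟩
    exact norm_nonneg g
  · intro h
    have hleast : IsLeast {r : ℝ | ∃ f : Bergman p, (∀ j, φ j f = φ j F) ∧ r = ‖f‖} ‖F‖ := by
      refine ⟨⟨F, fun _ ↦ rfl, rfl⟩, ?_⟩
      rintro r ⟨f, hf, rfl⟩
      exact h f hf
    exact hleast.csInf_eq.symm

/-- Extremal functionals of a function of the Bergman space are unique up to scaling. -/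
theorem IsExtremalFor.mem_span_singleton (hp : 1 < p) (hp' : p < ∞)
    {ψ χ : StrongDual ℂ (Bergman p)} {F : Bergman p} (hψ : IsExtremalFor ψ F)
    (hχ : IsExtremalFor χ F) : χ ∈ Submodule.span ℂ {ψ} := by
  have hF : ‖F‖ = 1 := hψ.2.1
  have hF0 : (F : Lp ℂ p discMeasure) ≠ 0 := by
    rw [← norm_ne_zero_iff, ← Submodule.coe_norm, hF]
    exact one_ne_zero
  have hd (g : Bergman p) : ∃ d : ℝ, HasDerivAt (fun t : ℝ ↦ ‖F + (t : ℂ) • g‖) d 0 :=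
    -- The norm is inherited from `L^p`, and so is its differentiability.
    Lp_exists_hasDerivAt_norm_add_smul hp hp' hF0 (g : Lp ℂ p discMeasure)
  have h := norm_smul_eq_norm_smul_of_hasDerivAt_norm (ψ := χ) (χ := ψ) (x := F)
    (by rw [hF, mul_one, ((isExtremalFor_iff hF).1 hχ).2])
    (by rw [hF, mul_one, ((isExtremalFor_iff hF).1 hψ).2]) hd
  have hψ0 : (‖ψ‖ : ℂ) ≠ 0 :=
    Complex.ofReal_ne_zero.2 (mt ψ.opNorm_zero_iff.1 hψ.1)
  refine Submodule.mem_span_singleton.2 ⟨(‖ψ‖ : ℂ)⁻¹ * ‖χ‖, ?_⟩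
  rw [mul_smul, ← h, inv_smul_smul₀ hψ0]

theorem isMinimalInterpolant_of_isExtremalFor {N : ℕ} {φ : Fin N → StrongDual ℂ (Bergman p)}
    {ψ : StrongDual ℂ (Bergman p)} {F : Bergman p} (hψF : IsExtremalFor ψ F)
    (hψ : ψ ∈ Submodule.span ℂ (Set.range φ)) : IsMinimalInterpolant φ F := by
  obtain ⟨h0, h⟩ := (isExtremalFor_iff hψF.2.1).1 hψF
  refine isMinimalInterpolant_iff.2 fun f hf ↦ ?_
  obtain ⟨c, rfl⟩ := (Submodule.mem_span_range_iff_exists_fun ℂ).1 hψ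
  set ψ := ∑ j, c j • φ j with hψdef
  have hfF : ψ f = ψ F := by simp [hψdef, hf]
  have hle := (Complex.re_le_norm _).trans (ψ.le_opNorm f)
  rw [hfF, h] at hle
  rw [hψF.2.1]
  exact le_of_mul_le_mul_left (by linarith) 
    ((norm_nonneg ψ).lt_of_ne' (mt ψ.opNorm_zero_iff.1 h0))

theorem IsMinimalInterpolant.exists_isExtremalFor {N : ℕ}
    {φ : Fin N → StrongDual ℂ (Bergman p)} {F : Bergman p} (hF : ‖F‖ = 1)
    (h : IsMinimalInterpolant φ F) :
    ∃ ψ, IsExtremalFor ψ F ∧ ψ ∈ Submodule.span ℂ (Set.range φ) := by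
  obtain ⟨ψ, hψ, hψ1, hψF⟩ := exists_mem_span_norm_eq_one_of_forall_norm_le φ
    (norm_ne_zero_iff.1 (by rw [hF]; exact one_ne_zero)) (isMinimalInterpolant_iff.1 h)
  refine ⟨ψ, (isExtremalFor_iff hF).2 ⟨mt ψ.opNorm_zero_iff.2 (by simp [hψ1]), ?_⟩, hψ⟩
  rw [hψF, hF, hψ1, Complex.ofReal_one, Complex.one_re]

/-- By Hahn–Banach; this keeps the "every" condition from being vacuous. -/
theorem exists_isExtremalFor {F : Bergman p} (hF : ‖F‖ = 1) : ∃ ψ, IsExtremalFor ψ F := by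
  obtain ⟨ψ, hψ, hψF⟩ := exists_dual_vector ℂ F (by rw [hF]; exact one_ne_zero)
  refine ⟨ψ, (isExtremalFor_iff hF).2 ⟨mt ψ.opNorm_zero_iff.2 (by simp [hψ]), ?_⟩⟩
  rw [hψF, hF, hψ]
  simp

end Bergman

theorem mainTheorem9 (p q : ℝ≥0∞) [Fact (1 ≤ p)] (hp : 1 < p) (hp' : p < ∞)
    (hpq : 1 / p + 1 / q = 1) (N : ℕ)
    (φ : Fin N → StrongDual ℂ (Bergman p)) (hφ : LinearIndependent ℂ φ)
    (k : Fin N → Bergman q) (hk : ∀ j, IsKernel (φ j) (k j))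
    (F : Bergman p) (hF : ‖F‖ = 1) :
    ((∃ ψ : StrongDual ℂ (Bergman p), IsExtremalFor ψ F ∧
        ∃ κ ∈ Submodule.span ℂ (Set.range k), IsKernel ψ κ) ↔ IsMinimalInterpolant φ F) ∧
    ((∀ ψ : StrongDual ℂ (Bergman p), IsExtremalFor ψ F →
        ∃ κ ∈ Submodule.span ℂ (Set.range k), IsKernel ψ κ) ↔ IsMinimalInterpolant φ F) := by
  have : p.HolderConjugate q := ENNReal.holderConjugate_iff.2 (by simpa using hpq)
  simp_rw [exists_isKernel_mem_span_iff hk]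
  refine ⟨⟨fun ⟨ψ, hψF, hψ⟩ ↦ isMinimalInterpolant_of_isExtremalFor hψF hψ,
    fun h ↦ h.exists_isExtremalFor hF⟩, fun h ↦ ?_, fun h χ hχ ↦ ?_⟩
  · obtain ⟨ψ, hψF⟩ := exists_isExtremalFor hF
    exact isMinimalInterpolant_of_isExtremalFor hψF (h ψ hψF)
  · obtain ⟨ψ, hψF, hψ⟩ := h.exists_isExtremalFor hF
    exact Submodule.span_le.2 (Set.singleton_subset_iff.2 hψ)
      (hψF.mem_span_singleton hp hp' hχ)
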